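/- Let $X$ be a finite connected graph in the sense of Serre (a finite set of vertices, a finite set of oriented edges with a fixed-point-free involution $a\mapsto -a$, an origin $o(a)$ and an extremity $e(a)=o(-a)$ for each edge), let $T$ be a maximal tree of $X$, and let $\mathcal G$ be a graph of groups on $X$: an orientation of $X$, vertex groups $G_s$, an edge group $G_a=G_{-a}$ for each positive edge $a$, and monomorphisms $\phi_a:G_a\to G_{o(a)}$, $\phi_{-a}:G_a\to G_{e(a)}$. Let $\Gamma=\pi_1(\mathcal G,X)$ be its fundamental group, i.e. the quotient of the free product of all the $G_s$ and the free group on letters $t_a$ by the relations $\phi_a(h)=t_a\phi_{-a}(h)t_a^{-1}$ ($a$ a positive edge, $h\in G_a$), $t_{-a}=t_a^{-1}$, and $t_a=1$ for $a$ in $T$. Identify each $G_s$ with its image under the canonical embedding in $\Gamma$; for an edge $a$ write $G_a^-\subseteq G_{o(a)}$ and $G_a^+\subseteq G_{e(a)}$ for the images of $\phi_a$ and $\phi_{-a}$ in $\Gamma$, and $\varphi_a:G_a^-\to G_a^+$ for the isomorphism $\phi_{-a}\circ\phi_a^{-1}$. A *circuit* at $u\in G_s$ with origin $s$ consists of a closed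 path $(a_1,\dots,a_n)$, $n\ge 0$, of $X$ with successive vertices $s=s_0,s_1,\dots,s_n=s$, of elements $c_i^-\in G_{a_i}^-$ and $c_i^+=\varphi_{a_i}(c_i^-)$ for $1\le i\le n$, and of elements $h_i\in G_{s_i}$ for $0\le i\le n$, such that $u=h_0c_1^-h_0^{-1}$, $c_i^+=h_ic_{i+1}^-h_i^{-1}$ for $1\le i<n$, and $c_n^+=h_nuh_n^{-1}$ (if $n=0$, simply $u=h_0uh_0^{-1}$). It is *trivial* if $n=0$, and *reduced* if there is no $i$ with $1\le i<n$, $a_{i+1}=-a_i$ and $h_i\in G_{a_i}^+$. Assume that $(\mathcal G,X,T)$ is *minimal* (for each positive edge $a$ of $T$, the subgroup $G_a=G_a^-=G_a^+$ of $\Gamma$ is a proper subgroup of $G_{o(a)}$ and of $G_{e(a)}$) and *without circuits* (for every $u\neq1$ in a vertex group, every reduced circuit at $u$ is trivial). Then at least one of the following holds: (i) the centre $Z(\Gamma)$ is trivial; (ii) $X$ consists of a single vertex $s$ and no edge, and $Z(\Gamma)=Z(G_s)$; (iii) $X$ consists of a single vertex $s$ and a single unoriented edge $\{a,-a\}$,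 the group $G_s$ is trivial, and $Z(\Gamma)=\Gamma\cong\mathbb Z$. -/

import Mathlib

universe uV uE uG uA

/-- A graph in the sense of Serre: `V` is the set of vertices, `E` the set of (oriented) edges,
`inv` is the fixed-point-free involution `a ↦ -a`, and `o a` is the origin of `a`. -/
structure SerreGraph (V : Type uV) (E : Type uE) where
  inv : E → E
  inv_inv : ∀ a, inv (inv a) = a
  inv_ne : ∀ a, inv a ≠ a
  o : E → V

namespace SerreGraph

variable {V : Type uV} {E : Type uE} (X : SerreGraph V E)

/-- The extremity (terminal vertex) of an edge, `e = o ∘ j`. -/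
def e (a : E) : V := X.o (X.inv a)

/-- `X.IsPath s l t`: the finite sequence of edges `l` is a path from `s` to `t`
(the empty sequence is the path reduced to the vertex `s`). -/
def IsPath : V → List E → V → Prop
  | s, [], t => s = t
  | s, a :: l, t => X.o a = s ∧ IsPath (X.e a) l t

/-- A path is reduced if `a_i ≠ -a_{i+1}` for all `i`. -/
def IsReducedPath (l : List E) : Prop := l.IsChain (fun a b => a ≠ X.inv b)

/-- Any two vertices are joined by a path. -/
def IsConnected : Prop := ∀ s t : V, ∃ l : List E, X.IsPath s l t

/-- `T` is the edge set of a maximal tree of `X`: the subgraph with all the vertices of `X` and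
with edge set `T` is a tree, that is, any two vertices are joined by a unique reduced path in it. -/
structure IsMaximalTree (T : Set E) : Prop where
  inv_mem : ∀ a ∈ T, X.inv a ∈ T
  existsUnique_path : ∀ s t : V,
    ∃! l : List E, (∀ a ∈ l, a ∈ T) ∧ X.IsPath s l t ∧ X.IsReducedPath l

end SerreGraph

/-- A graph of groups on `X`: an orientation `pos` of `X`, vertex groups `Gv s`, edge groups `Ge a`
for the positively oriented edges `a`, and for those the monomorphisms
`φ_a : G_a → G_{o(a)}` (here `phiO a`) and `φ_{-a} : G_a → G_{e(a)}` (here `phiE a`). -/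
structure GraphOfGroups {V : Type uV} {E : Type uE} (X : SerreGraph V E) where
  pos : Set E
  pos_iff : ∀ a, a ∈ pos ↔ X.inv a ∉ pos
  Gv : V → Type uG
  [groupGv : ∀ s, Group (Gv s)]
  Ge : pos → Type uA
  [groupGe : ∀ a, Group (Ge a)]
  phiO : ∀ a : pos, Ge a →* Gv (X.o a)
  phiE : ∀ a : pos, Ge a →* Gv (X.e a)
  phiO_injective : ∀ a, Function.Injective (phiO a)
  phiE_injective : ∀ a, Function.Injective (phiE a)

attribute [instance] GraphOfGroups.groupGv GraphOfGroups.groupGe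

namespace GraphOfGroups

variable {V : Type uV} {E : Type uE} {X : SerreGraph V E}
  (𝒢 : GraphOfGroups.{uV, uE, uG, uA} X) (T : Set E)

/-- The free product of all the vertex groups and of the free group on the letters `t_a`, `a ∈ E`. -/
abbrev FreeAmbient : Type (max uV uE uG) :=
  Monoid.Coprod (Monoid.CoprodI 𝒢.Gv) (FreeGroup E)

/-- An element of a vertex group, in the free product. -/
def vtx (s : V) : 𝒢.Gv s →* 𝒢.FreeAmbient :=
  Monoid.Coprod.inl.comp Monoid.CoprodI.of

/-- The letter `t_a`, in the free product. -/
def letter (a : E) : 𝒢.FreeAmbient := Monoid.Coprod.inr (FreeGroup.of a)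

/-- The relators for `φ_a(h) = t_a φ_{-a}(h) t_a⁻¹` (`a` positive, `h ∈ G_a`), for
`t_{-a} = t_a⁻¹`, and for `t_a = 1` (`a ∈ T`). -/
def relators : Set 𝒢.FreeAmbient :=
  {x | ∃ (a : 𝒢.pos) (h : 𝒢.Ge a), x = 𝒢.vtx _ (𝒢.phiO a h) *
      (𝒢.letter a * 𝒢.vtx _ (𝒢.phiE a h) * (𝒢.letter a)⁻¹)⁻¹} ∪
  {x | ∃ a : E, x = 𝒢.letter (X.inv a) * ((𝒢.letter a)⁻¹)⁻¹} ∪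
  {x | ∃ a ∈ T, x = 𝒢.letter a}

/-- The fundamental group of the graph of groups, relative to the maximal tree `T`. -/
abbrev Pi1 : Type (max uV uE uG) :=
  𝒢.FreeAmbient ⧸ Subgroup.normalClosure (𝒢.relators T)

/-- The natural map `Π_s` from the vertex group `G_s` to the fundamental group. -/
def toPi1 (s : V) : 𝒢.Gv s →* 𝒢.Pi1 T := (QuotientGroup.mk' _).comp (𝒢.vtx s)

/-- The vertex subgroup `G_s` of the fundamental group. -/
def vertexSubgroup (s : V) : Subgroup (𝒢.Pi1 T) := (𝒢.toPi1 T s).range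

open Classical in
/-- The positive edge among `a`, `-a`; the group `G_a` of any edge `a` is `𝒢.Ge (𝒢.posEdge a)`. -/
noncomputable def posEdge (a : E) : 𝒢.pos :=
  if h : a ∈ 𝒢.pos then ⟨a, h⟩
  else ⟨X.inv a, by by_contra h'; exact h ((𝒢.pos_iff a).2 h')⟩

open Classical in
/-- `Π_{o(a)} ∘ φ_a`, for an arbitrary edge `a`. -/
noncomputable def edgeMinusHom (a : E) : 𝒢.Ge (𝒢.posEdge a) →* 𝒢.Pi1 T :=
  if a ∈ 𝒢.pos then (𝒢.toPi1 T _).comp (𝒢.phiO (𝒢.posEdge a))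
  else (𝒢.toPi1 T _).comp (𝒢.phiE (𝒢.posEdge a))

open Classical in
/-- `Π_{e(a)} ∘ φ_{-a}`, for an arbitrary edge `a`. -/
noncomputable def edgePlusHom (a : E) : 𝒢.Ge (𝒢.posEdge a) →* 𝒢.Pi1 T :=
  if a ∈ 𝒢.pos then (𝒢.toPi1 T _).comp (𝒢.phiE (𝒢.posEdge a))
  else (𝒢.toPi1 T _).comp (𝒢.phiO (𝒢.posEdge a))

/-- The edge subgroup `G_a⁻ ⊆ G_{o(a)}` of the fundamental group. -/
noncomputable def edgeMinus (a : E) : Subgroup (𝒢.Pi1 T) := (𝒢.edgeMinusHom T a).range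

/-- The edge subgroup `G_a⁺ ⊆ G_{e(a)}` of the fundamental group. -/
noncomputable def edgePlus (a : E) : Subgroup (𝒢.Pi1 T) := (𝒢.edgePlusHom T a).range

/-- The graph of the isomorphism `φ_a : G_a⁻ → G_a⁺`: `x ∈ G_a⁻`, `y ∈ G_a⁺` and `y = φ_a(x)`. -/
def EdgeIso (a : E) (x y : 𝒢.Pi1 T) : Prop :=
  ∃ c : 𝒢.Ge (𝒢.posEdge a), x = 𝒢.edgeMinusHom T a c ∧ y = 𝒢.edgePlusHom T a c

/-- Minimality: for each positive edge `a` of `T`, the edge subgroup `G_a = G_a⁻ = G_a⁺` is a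
proper subgroup of both vertex subgroups `G_{o(a)}` and `G_{e(a)}`. -/
def IsMinimal : Prop :=
  ∀ a ∈ T, a ∈ 𝒢.pos →
    𝒢.edgeMinus T a < 𝒢.vertexSubgroup T (X.o a) ∧
    𝒢.edgePlus T a < 𝒢.vertexSubgroup T (X.e a)

/-- A route ("trajet") from `u ∈ G_{so}` to `v ∈ G_{se}`, with origin `so` and extremity `se`:
a path `(a_1, …, a_n)` through vertices `s_0 = so, …, s_n = se`, elements `c_i⁻ ∈ G_{a_i}⁻` and
`c_i⁺ = φ_{a_i}(c_i⁻)`, and `h_i ∈ G_{s_i}` with `u = h_0 c_1⁻ h_0⁻¹`,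
`c_i⁺ = h_i c_{i+1}⁻ h_i⁻¹` for `0 < i < n`, and `c_n⁺ = h_n v h_n⁻¹`
(just `u = h_0 v h_0⁻¹` if `n = 0`). -/
structure Trajet (so se : V) (u v : 𝒢.Pi1 T) where
  n : ℕ
  s : Fin (n + 1) → V
  a : Fin n → E
  cm : Fin n → 𝒢.Pi1 T
  cp : Fin n → 𝒢.Pi1 T
  h : Fin (n + 1) → 𝒢.Pi1 T
  u_mem : u ∈ 𝒢.vertexSubgroup T so
  v_mem : v ∈ 𝒢.vertexSubgroup T se
  s_first : s 0 = so
  s_last : s (Fin.last n) = se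
  o_edge : ∀ i : Fin n, X.o (a i) = s i.castSucc
  e_edge : ∀ i : Fin n, X.e (a i) = s i.succ
  edgeIso : ∀ i : Fin n, 𝒢.EdgeIso T (a i) (cm i) (cp i)
  h_mem : ∀ i, h i ∈ 𝒢.vertexSubgroup T (s i)
  conj : ∀ i : Fin (n + 1),
    (Fin.cons u cp : Fin (n + 1) → 𝒢.Pi1 T) i =
      h i * (Fin.snoc cm v : Fin (n + 1) → 𝒢.Pi1 T) i * (h i)⁻¹

variable {𝒢 T} in
/-- A route is reduced if it nowhere crosses an edge `a`, then uses an element of `G_a⁺`,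
and then crosses `-a`. -/
def Trajet.IsReduced {so se : V} {u v : 𝒢.Pi1 T} (τ : 𝒢.Trajet T so se u v) : Prop :=
  ∀ i j : Fin τ.n, i.val + 1 = j.val →
    ¬ (τ.a j = X.inv (τ.a i) ∧ τ.h i.succ ∈ 𝒢.edgePlus T (τ.a i))

/-- "Without circuits": for `u ≠ 1`, every reduced circuit at `u` is trivial, i.e. crosses no
edge. -/
def IsWithoutCircuit : Prop :=
  ∀ (s : V) (u : 𝒢.Pi1 T), u ≠ 1 →
    ∀ τ : 𝒢.Trajet T s s u u, τ.IsReduced → τ.n = 0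

end GraphOfGroups

/-! Without circuits, the centralizer of a nontrivial element `u` of `G_s` stays inside `G_s`
(`IsWithoutCircuit.mem_vertexSubgroup`). Indeed any `γ` equals `h₀ t_{a_1} h_1 ⋯ t_{a_n} h_n` for a
reduced closed word at `s` (`isReducedVal`). If `uγ = γu`, peeling off the letters one by one turns
this word into a reduced circuit at `u` (`IsWord.exists_trajet`), so `n = 0`.

Let `z ≠ 1` be central. If some `G_s` contains `u ≠ 1`, then `z` centralizes `u`, so `z ∈ G_s`;
every `γ` centralizes `z`, so `Γ = G_s`. A tree edge at `s` would, by minimality, give a reduced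
word with value outside `G_s`, and so would a loop; hence `X` is a point. If all vertex groups are
trivial, minimality leaves no tree edge, so `X` is a bouquet of loops: no loop makes `Γ` trivial,
one gives `ℤ`, and two or more force a trivial centre.

All this rests on a comparison of reduced words (`IsWord.exists_eq_cons`), obtained by van der
Waerden's method. The free product of the vertex groups, with a stable letter for every edge, tree
edges included, acts on normal words. To make `Γ` act, `G_s` is conjugated by the product `p_s` of
the letters along the tree path from a base vertex to `s`, and `t_a` acts as `p_{o(a)} τ_a
p_{e(a)}⁻¹`, where `τ_a` is the letter permutation; this is trivial for `a` in the tree. Along a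
path these conjugations telescope, and a reduced word applied to a normal word without letters never
cancels (`HNNData.evalPerm_baseWord`). -/

/-- Representatives of the right cosets of a subgroup, the trivial coset being represented by the
neutral element. -/
theorem Subgroup.exists_rightCosetRep {A : Type*} [Group A] (K : Subgroup A) :
    ∃ rep : A → A, (∀ h, h * (rep h)⁻¹ ∈ K) ∧ (∀ k ∈ K, ∀ h, rep (k * h) = rep h) ∧
      rep 1 = 1 := by
  classical
  refine ⟨fun h => if h ∈ K then 1 else
    Quotient.out (Quotient.mk (QuotientGroup.rightRel K) h), fun h => ?_, fun k hk h => ?_, ?_⟩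
  · dsimp only
    split_ifs with hh
    · simpa using hh
    · exact QuotientGroup.rightRel_apply.1
        (Quotient.exact (Quotient.out_eq (Quotient.mk (QuotientGroup.rightRel K) h)))
  · have h1 : k * h ∈ K ↔ h ∈ K := Subgroup.mul_mem_cancel_left _ hk
    have h2 : Quotient.mk (QuotientGroup.rightRel K) (k * h) =
        Quotient.mk (QuotientGroup.rightRel K) h := by
      apply Quotient.sound
      apply QuotientGroup.rightRel_apply.2
      simpa using K.inv_mem hk
    simp only [h1, h2]
  · simp [K.one_mem]

namespace Subgroup

variable {A : Type*} [Group A] (K : Subgroup A)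

/-- The chosen representative of a right coset. -/
noncomputable def rightCosetRep : A → A := K.exists_rightCosetRep.choose

theorem mul_inv_rightCosetRep_mem (h : A) : h * (K.rightCosetRep h)⁻¹ ∈ K :=
  K.exists_rightCosetRep.choose_spec.1 h

theorem rightCosetRep_mul {k : A} (hk : k ∈ K) (h : A) :
    K.rightCosetRep (k * h) = K.rightCosetRep h :=
  K.exists_rightCosetRep.choose_spec.2.1 k hk h

theorem rightCosetRep_one : K.rightCosetRep 1 = 1 := K.exists_rightCosetRep.choose_spec.2.2

theorem rightCosetRep_eq_one {h : A} : K.rightCosetRep h = 1 ↔ h ∈ K := by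
  constructor
  · intro e
    simpa [e] using K.mul_inv_rightCosetRep_mem h
  · intro hk
    simpa [rightCosetRep_one] using K.rightCosetRep_mul hk 1

theorem rightCosetRep_rightCosetRep (h : A) :
    K.rightCosetRep (K.rightCosetRep h) = K.rightCosetRep h := by
  simpa using (K.rightCosetRep_mul (K.mul_inv_rightCosetRep_mem h) (K.rightCosetRep h)).symm

end Subgroup

/-! ### Multiple HNN extensions: normal words and the action on them -/

/-- The data of a multiple HNN extension of a group `A`: stable letters `a ∈ E` with an involution,
and partial isomorphisms `ψ_a : K_a → K_{-a}` between subgroups of `A`, with `ψ_{-a} = ψ_a⁻¹`. -/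
structure HNNData (A : Type*) [Group A] (E : Type*) where
  inv : E → E
  inv_inv : ∀ a, inv (inv a) = a
  K : E → Subgroup A
  ψ : E → A → A
  ψ_mem : ∀ a, ∀ x ∈ K a, ψ a x ∈ K (inv a)
  ψ_mul : ∀ a, ∀ x ∈ K a, ∀ y ∈ K a, ψ a (x * y) = ψ a x * ψ a y
  ψ_ψ : ∀ a, ∀ x ∈ K a, ψ (inv a) (ψ a x) = x

namespace HNNData

variable {A : Type*} [Group A] {E : Type*} (D : HNNData A E)

/-- The representative of the right coset of `h` modulo `K_{-a}`. -/
noncomputable def rep (a : E) : A → A := (D.K (D.inv a)).rightCosetRep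

/-- The word `t_{a_1} r_1 ⋯ t_{a_n} r_n` is normal if each `r_i` is a coset representative and no
`r_i = 1` stands between `t_a` and `t_{-a}`. -/
def IsNormal (l : List (E × A)) : Prop :=
  (∀ x ∈ l, D.rep x.1 x.2 = x.2) ∧ l.IsChain (fun x y => y.1 = D.inv x.1 → x.2 ≠ 1)

/-- Normal words `h t_{a_1} r_1 ⋯ t_{a_n} r_n`. -/
def NormalWord : Type _ := {w : A × List (E × A) // D.IsNormal w.2}

/-- The element of `K_a` that comes out when `t_a` is moved to the right across `K_{-a}` in
`t_a h`. -/
noncomputable def carry (a : E) (h : A) : A := D.ψ (D.inv a) (h * (D.rep a h)⁻¹)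

open Classical in
/-- Left multiplication of a word by the letter `t_a`. -/
noncomputable def cross (a : E) (w : A × List (E × A)) : A × List (E × A) :=
  match w with
  | (h, []) => (D.carry a h, [(a, D.rep a h)])
  | (h, x :: l) =>
    if h ∈ D.K (D.inv a) ∧ x.1 = D.inv a then (D.carry a h * x.2, l)
    else (D.carry a h, (a, D.rep a h) :: x :: l)

theorem mul_inv_rep_mem (a : E) (h : A) : h * (D.rep a h)⁻¹ ∈ D.K (D.inv a) :=
  Subgroup.mul_inv_rightCosetRep_mem _ h

theorem carry_mem (a : E) (h : A) : D.carry a h ∈ D.K a := by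
  have := D.ψ_mem (D.inv a) _ (D.mul_inv_rep_mem a h)
  rwa [D.inv_inv] at this

theorem rep_eq_one {a : E} {h : A} : D.rep a h = 1 ↔ h ∈ D.K (D.inv a) :=
  Subgroup.rightCosetRep_eq_one _

theorem carry_mul {a : E} {k : A} (hk : k ∈ D.K (D.inv a)) (h : A) :
    D.carry a (k * h) = D.ψ (D.inv a) k * D.carry a h := by
  have e : D.rep a (k * h) = D.rep a h := Subgroup.rightCosetRep_mul _ hk h
  rw [carry, e, mul_assoc, D.ψ_mul _ _ hk _ (D.mul_inv_rep_mem a h), carry]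

/-- This recovers `h` from the rewriting `t_a h = carry · t_a · rep`, so crossing a letter loses no
information. -/
theorem ψ_carry (a : E) (h : A) : D.ψ a (D.carry a h) * D.rep a h = h := by
  have := D.ψ_ψ (D.inv a) _ (D.mul_inv_rep_mem a h)
  rw [D.inv_inv] at this
  rw [carry, this, inv_mul_cancel_right]

theorem carry_of_mem {a : E} {h : A} (hh : h ∈ D.K (D.inv a)) :
    D.carry a h = D.ψ (D.inv a) h := by
  rw [carry, D.rep_eq_one.2 hh, inv_one, mul_one]

theorem isNormal_nil : D.IsNormal [] := ⟨by simp, by simp⟩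

theorem cross_of_not {a : E} {h : A} {l : List (E × A)}
    (hw : ∀ x l', l = x :: l' → ¬ (h ∈ D.K (D.inv a) ∧ x.1 = D.inv a)) :
    D.cross a (h, l) = (D.carry a h, (a, D.rep a h) :: l) := by
  cases l with
  | nil => rfl
  | cons x l => exact if_neg (hw x l rfl)

theorem cross_of_mem {a : E} {h : A} (hh : h ∈ D.K (D.inv a)) (r : A) (l : List (E × A)) :
    D.cross a (h, (D.inv a, r) :: l) = (D.carry a h * r, l) := if_pos ⟨hh, rfl⟩

theorem cross_cases (a : E) (h : A) (l : List (E × A)) :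
    (h ∈ D.K (D.inv a) ∧ ∃ r l', l = (D.inv a, r) :: l') ∨
      ∀ x l', l = x :: l' → ¬ (h ∈ D.K (D.inv a) ∧ x.1 = D.inv a) := by
  by_contra! hc
  obtain ⟨h1, ⟨b, r⟩, l', rfl, hh, rfl⟩ := hc
  exact h1 hh r l' rfl

theorem isNormal_cross (a : E) {w : A × List (E × A)} (hw : D.IsNormal w.2) :
    D.IsNormal (D.cross a w).2 := by
  obtain ⟨h, l⟩ := w
  rcases D.cross_cases a h l with ⟨hh, r, l', rfl⟩ | hn
  · rw [D.cross_of_mem hh]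
    exact ⟨fun x hx => hw.1 x (List.mem_cons_of_mem _ hx), hw.2.tail⟩
  · rw [D.cross_of_not hn]
    refine ⟨?_, ?_⟩
    · intro x hx
      rcases List.mem_cons.1 hx with rfl | hx
      · exact Subgroup.rightCosetRep_rightCosetRep _ _
      · exact hw.1 x hx
    · cases l with
      | nil => exact List.isChain_singleton _
      | cons x l =>
        refine List.IsChain.cons_cons (fun hx h1 => hn x l rfl ⟨D.rep_eq_one.1 h1, hx⟩) hw.2

theorem cross_cross (a : E) {w : A × List (E × A)} (hw : D.IsNormal w.2) :
    D.cross (D.inv a) (D.cross a w) = w := by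
  obtain ⟨h, l⟩ := w
  rcases D.cross_cases a h l with ⟨hh, r, l', rfl⟩ | hn
  · rw [D.cross_of_mem hh]
    have hK : D.carry a h ∈ D.K (D.inv (D.inv a)) := by
      rw [D.inv_inv]; exact D.carry_mem a h
    have hr : D.rep (D.inv a) r = r := hw.1 (D.inv a, r) (by simp)
    have hrep : D.rep (D.inv a) (D.carry a h * r) = r :=
      ((Subgroup.rightCosetRep_mul _ hK r).trans hr)
    have hc : D.carry (D.inv a) (D.carry a h * r) = h := by
      have h1 : D.carry (D.inv a) r = 1 := by
        have e := D.ψ_ψ a 1 (one_mem _)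
        have e1 : D.ψ a 1 = 1 := by
          have := D.ψ_mul a 1 (one_mem _) 1 (one_mem _)
          simpa using this
        rw [carry, hr, mul_inv_cancel, D.inv_inv, e1]
      rw [D.carry_mul hK, h1, mul_one, D.inv_inv]
      have := D.ψ_carry a h
      rwa [D.rep_eq_one.2 hh, mul_one] at this
    rw [D.cross_of_not, hc, hrep]
    -- A second cancellation would force `r = 1` between `t_{-a}` and `t_a`, against normality.
    rintro x l rfl ⟨h1, h2⟩
    have h3 := (List.isChain_cons_cons.1 hw.2).1 h2
    apply h3
    have := D.rep_eq_one.2 h1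
    rwa [hrep] at this
  · have hK : D.carry a h ∈ D.K (D.inv (D.inv a)) := by
      rw [D.inv_inv]; exact D.carry_mem a h
    rw [D.cross_of_not hn]
    have : D.cross (D.inv a) (D.carry a h, (D.inv (D.inv a), D.rep a h) :: l) = (h, l) := by
      rw [D.cross_of_mem hK, D.carry_of_mem hK, D.inv_inv, D.ψ_carry]
    rwa [D.inv_inv] at this

/-- The relation `t_a k = ψ_{-a}(k) t_a` in the action: left multiplication by `k ∈ K_{-a}` changes
neither the coset representative nor whether a cancellation occurs. -/
theorem cross_mul {a : E} {k : A} (hk : k ∈ D.K (D.inv a)) (h : A) (l : List (E × A)) :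
    D.cross a (k * h, l) =
      (D.ψ (D.inv a) k * (D.cross a (h, l)).1, (D.cross a (h, l)).2) := by
  have hkh : k * h ∈ D.K (D.inv a) ↔ h ∈ D.K (D.inv a) := Subgroup.mul_mem_cancel_left _ hk
  have e : D.rep a (k * h) = D.rep a h := Subgroup.rightCosetRep_mul _ hk h
  rcases D.cross_cases a h l with ⟨hh, r, l', rfl⟩ | hn
  · rw [D.cross_of_mem hh, D.cross_of_mem (hkh.2 hh), D.carry_mul hk, mul_assoc]
  · rw [D.cross_of_not hn, D.cross_of_not (by simpa only [hkh] using hn), e, D.carry_mul hk]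

/-- The permutation of the normal words given by the letter `t_a`. -/
noncomputable def letterPerm (a : E) : Equiv.Perm D.NormalWord where
  toFun w := ⟨D.cross a w.1, D.isNormal_cross a w.2⟩
  invFun w := ⟨D.cross (D.inv a) w.1, D.isNormal_cross _ w.2⟩
  left_inv w := Subtype.ext (D.cross_cross a w.2)
  right_inv w := Subtype.ext (by
    have := D.cross_cross (D.inv a) w.2
    rwa [D.inv_inv] at this)

/-- The action of `A` on the normal words by left multiplication. -/
def basePerm : A →* Equiv.Perm D.NormalWord where
  toFun x :=
    { toFun := fun w => ⟨(x * w.1.1, w.1.2), w.2⟩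
      invFun := fun w => ⟨(x⁻¹ * w.1.1, w.1.2), w.2⟩
      left_inv := fun w => Subtype.ext (Prod.ext (by simp) rfl)
      right_inv := fun w => Subtype.ext (Prod.ext (by simp) rfl) }
  map_one' := Equiv.ext fun w => Subtype.ext (Prod.ext (one_mul _) rfl)
  map_mul' x y := Equiv.ext fun w => Subtype.ext (Prod.ext (mul_assoc _ _ _) rfl)

theorem basePerm_apply (x : A) (w : D.NormalWord) :
    (D.basePerm x w).1 = (x * w.1.1, w.1.2) := rfl

theorem letterPerm_inv (a : E) : D.letterPerm (D.inv a) = (D.letterPerm a)⁻¹ := by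
  ext w; rfl

theorem letterPerm_mul_basePerm {a : E} {k : A} (hk : k ∈ D.K (D.inv a)) :
    D.letterPerm a * D.basePerm k = D.basePerm (D.ψ (D.inv a) k) * D.letterPerm a := by
  ext w
  apply Subtype.ext
  exact D.cross_mul hk w.1.1 w.1.2

/-- The word with head `x` and no letter. -/
def baseWord (x : A) : D.NormalWord := ⟨(x, []), D.isNormal_nil⟩

theorem basePerm_injective : Function.Injective D.basePerm := by
  intro x y h
  have := congrArg (fun p => (p (D.baseWord 1)).1.1) h
  rwa [basePerm_apply, basePerm_apply, baseWord, mul_one, mul_one] at this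

/-- `t_{a_1} x_1 ⋯ t_{a_n} x_n` as a permutation of the normal words. -/
noncomputable def evalPerm (l : List (E × A)) : Equiv.Perm D.NormalWord :=
  (l.map fun x => D.letterPerm x.1 * D.basePerm x.2).prod

theorem evalPerm_cons (x : E × A) (l : List (E × A)) :
    D.evalPerm (x :: l) = D.letterPerm x.1 * D.basePerm x.2 * D.evalPerm l := by
  simp [evalPerm]

/-- Britton's lemma for the action. Once `t_b` has been added, the head lies in `K_b`. If the letter
`t_a` to its left cancelled it, then `b = -a` and `x · head ∈ K_{-a}`, hence `x ∈ K_{-a}`, which the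
hypothesis forbids. The membership of the head is what makes the induction work. -/
theorem evalPerm_baseWord (l : List (E × A)) (y : A)
    (hl : l.IsChain fun x y => y.1 = D.inv x.1 → x.2 ∉ D.K (D.inv x.1)) (a : E) (x : A)
    (l' : List (E × A)) (e : l = (a, x) :: l') :
    (D.evalPerm l (D.baseWord y)).1.1 ∈ D.K a ∧
      ∃ r m, (D.evalPerm l (D.baseWord y)).1.2 = (a, r) :: m := by
  induction l generalizing a x l' with
  | nil => simp at e
  | cons z l ih =>
    obtain ⟨rfl, rfl⟩ := List.cons.inj e
    have hev : (D.evalPerm ((a, x) :: l) (D.baseWord y)).1 =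
        D.cross a (x * (D.evalPerm l (D.baseWord y)).1.1,
          (D.evalPerm l (D.baseWord y)).1.2) := by
      rw [evalPerm_cons]; rfl
    rw [hev, D.cross_of_not]
    · exact ⟨D.carry_mem _ _, _, _, rfl⟩
    · rintro ⟨b, r⟩ m hm ⟨h1, rfl : b = _⟩
      cases l with
      | nil => exact absurd hm (List.cons_ne_nil _ _).symm
      | cons z l =>
        obtain ⟨h2, r', m', h3⟩ := ih hl.tail z.1 z.2 l rfl
        have hm' : (D.evalPerm (z :: l) (D.baseWord y)).1.2 = (D.inv a, r) :: m := hm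
        rw [hm'] at h3
        have hz : D.inv a = z.1 := congrArg Prod.fst (List.cons.inj h3).1
        rw [← hz] at h2
        exact (List.isChain_cons_cons.1 hl).1 hz.symm ((Subgroup.mul_mem_cancel_right _ h2).1 h1)

end HNNData

/-! ### Paths in the maximal tree -/

namespace SerreGraph

variable {V : Type uV} {E : Type uE} {X : SerreGraph V E}

theorem e_inv (a : E) : X.e (X.inv a) = X.o a := by rw [e, X.inv_inv]

theorem isPath_append {s t : V} {l l' : List E} :
    X.IsPath s (l ++ l') t ↔ ∃ m, X.IsPath s l m ∧ X.IsPath m l' t := by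
  induction l generalizing s with
  | nil => simp [IsPath]
  | cons a l ih =>
    simp only [List.cons_append, IsPath, ih]
    constructor
    · rintro ⟨h, m, h1, h2⟩
      exact ⟨m, ⟨h, h1⟩, h2⟩
    · rintro ⟨m, ⟨h, h1⟩, h2⟩
      exact ⟨h, m, h1, h2⟩

namespace IsMaximalTree

variable {T : Set E} (hT : X.IsMaximalTree T)
include hT

/-- The reduced path of the tree between two vertices. -/
noncomputable def path (s t : V) : List E := (hT.existsUnique_path s t).choose

theorem mem_of_mem_path {s t : V} {a : E} (ha : a ∈ hT.path s t) : a ∈ T :=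
  (hT.existsUnique_path s t).choose_spec.1.1 a ha

theorem isPath_path (s t : V) : X.IsPath s (hT.path s t) t :=
  (hT.existsUnique_path s t).choose_spec.1.2.1

theorem isReducedPath_path (s t : V) : X.IsReducedPath (hT.path s t) :=
  (hT.existsUnique_path s t).choose_spec.1.2.2

theorem eq_path {s t : V} {l : List E} (h1 : ∀ a ∈ l, a ∈ T) (h2 : X.IsPath s l t)
    (h3 : X.IsReducedPath l) : l = hT.path s t :=
  (hT.existsUnique_path s t).choose_spec.2 l ⟨h1, h2, h3⟩

/-- If `f` is a function of the edges with values in a group and `f (-a) = f(a)⁻¹`, then its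
products along the paths of the tree form a potential of `f` on the tree. -/
theorem prod_path_mul {G : Type*} [Group G] (f : E → G) (hf : ∀ a, f (X.inv a) = (f a)⁻¹)
    (s : V) {a : E} (ha : a ∈ T) :
    ((hT.path s (X.o a)).map f).prod * f a = ((hT.path s (X.e a)).map f).prod := by
  rcases List.eq_nil_or_concat (hT.path s (X.o a)) with h | ⟨l, b, h⟩
  · have h1 := hT.isPath_path s (X.o a)
    rw [h] at h1
    obtain rfl : s = X.o a := h1
    rw [h, ← hT.eq_path (l := [a]) (by simpa using ha) ⟨rfl, rfl⟩ (List.isChain_singleton _)]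
    simp
  · rw [List.concat_eq_append] at h
    have h1 := hT.isPath_path s (X.o a)
    have h2 := hT.isReducedPath_path s (X.o a)
    have h3 : ∀ c ∈ l ++ [b], c ∈ T := fun c hc => hT.mem_of_mem_path (h ▸ hc)
    rw [h] at h1 h2
    rw [h]
    -- If the path to `o(a)` ends with `-a`, deleting that edge gives the reduced path to `e(a)`;
    -- otherwise appending `a` does.
    by_cases hb : b = X.inv a
    · rw [hb] at h1 h2 h3 ⊢
      obtain ⟨m, h4, h5, h6⟩ := isPath_append.1 h1
      obtain rfl : X.e a = m := h5
      rw [← hT.eq_path (l := l) (fun c hc => h3 c (by simp [hc])) h4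
        (List.isChain_append.1 h2).1]
      simp [hf]
    · rw [← hT.eq_path (l := l ++ [b] ++ [a])]
      · simp [mul_assoc]
      · intro c hc
        rcases List.mem_append.1 hc with hc | hc
        · exact h3 c hc
        · rwa [List.mem_singleton.1 hc]
      · exact isPath_append.2 ⟨_, h1, rfl, rfl⟩
      · refine List.isChain_append.2 ⟨h2, List.isChain_singleton _, ?_⟩
        simpa using hb

end IsMaximalTree

end SerreGraph

/-! ### The HNN data of a graph of groups, and the relations in its fundamental group -/

namespace GraphOfGroups

variable {V : Type uV} {E : Type uE} {X : SerreGraph V E}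
  (𝒢 : GraphOfGroups.{uV, uE, uG, uA} X) (T : Set E)

theorem inv_mem_pos {a : E} (h : a ∉ 𝒢.pos) : X.inv a ∈ 𝒢.pos := by
  by_contra h'
  exact h ((𝒢.pos_iff a).2 h')

theorem posEdge_of_mem {a : E} (h : a ∈ 𝒢.pos) : 𝒢.posEdge a = ⟨a, h⟩ := dif_pos h

theorem posEdge_of_notMem {a : E} (h : a ∉ 𝒢.pos) :
    𝒢.posEdge a = ⟨X.inv a, 𝒢.inv_mem_pos h⟩ := dif_neg h

/-- A vertex group in the free product of all the vertex groups. -/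
def baseVtx (s : V) : 𝒢.Gv s →* Monoid.CoprodI 𝒢.Gv := Monoid.CoprodI.of

theorem baseVtx_injective (s : V) : Function.Injective (𝒢.baseVtx s) :=
  Monoid.CoprodI.of_injective s

open Classical in
/-- The embedding `φ_a` of an arbitrary edge group in the free product of the vertex groups. -/
noncomputable def baseMinus (a : E) : 𝒢.Ge (𝒢.posEdge a) →* Monoid.CoprodI 𝒢.Gv :=
  if a ∈ 𝒢.pos then (𝒢.baseVtx _).comp (𝒢.phiO (𝒢.posEdge a))
  else (𝒢.baseVtx _).comp (𝒢.phiE (𝒢.posEdge a))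

open Classical in
/-- The embedding `φ_{-a}` of an arbitrary edge group in the free product of the vertex groups. -/
noncomputable def basePlus (a : E) : 𝒢.Ge (𝒢.posEdge a) →* Monoid.CoprodI 𝒢.Gv :=
  if a ∈ 𝒢.pos then (𝒢.baseVtx _).comp (𝒢.phiE (𝒢.posEdge a))
  else (𝒢.baseVtx _).comp (𝒢.phiO (𝒢.posEdge a))

/-- The graph of the isomorphism `φ_a` in the free product of the vertex groups. -/
def BaseIso (a : E) (x y : Monoid.CoprodI 𝒢.Gv) : Prop :=
  ∃ c, x = 𝒢.baseMinus a c ∧ y = 𝒢.basePlus a c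

theorem baseIso_of_mem {a : E} (h : a ∈ 𝒢.pos) {x y : Monoid.CoprodI 𝒢.Gv} :
    𝒢.BaseIso a x y ↔ ∃ c : 𝒢.Ge ⟨a, h⟩, x = 𝒢.baseVtx _ (𝒢.phiO ⟨a, h⟩ c) ∧
      y = 𝒢.baseVtx _ (𝒢.phiE ⟨a, h⟩ c) := by
  unfold BaseIso baseMinus basePlus
  rw [𝒢.posEdge_of_mem h, if_pos h, if_pos h]
  rfl

theorem baseIso_of_notMem {a : E} (h : a ∉ 𝒢.pos) {x y : Monoid.CoprodI 𝒢.Gv} :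
    𝒢.BaseIso a x y ↔ 𝒢.BaseIso (X.inv a) y x := by
  rw [𝒢.baseIso_of_mem (𝒢.inv_mem_pos h)]
  unfold BaseIso baseMinus basePlus
  rw [𝒢.posEdge_of_notMem h, if_neg h, if_neg h]
  exact exists_congr fun c => and_comm

theorem baseIso_inv {a : E} {x y : Monoid.CoprodI 𝒢.Gv} :
    𝒢.BaseIso (X.inv a) y x ↔ 𝒢.BaseIso a x y := by
  by_cases h : a ∈ 𝒢.pos
  · rw [𝒢.baseIso_of_notMem ((𝒢.pos_iff a).1 h), X.inv_inv]
  · rw [𝒢.baseIso_of_notMem h]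

theorem baseMinus_injective (a : E) : Function.Injective (𝒢.baseMinus a) := by
  unfold baseMinus
  split_ifs
  · exact (𝒢.baseVtx_injective _).comp (𝒢.phiO_injective _)
  · exact (𝒢.baseVtx_injective _).comp (𝒢.phiE_injective _)

open Classical in
/-- The isomorphism `φ_a`, as a function on the free product of the vertex groups. -/
noncomputable def baseMap (a : E) (x : Monoid.CoprodI 𝒢.Gv) : Monoid.CoprodI 𝒢.Gv :=
  -- The value `1` off the edge subgroup is arbitrary: `HNNData` constrains `ψ a` only on `K a`.
  if h : ∃ c, 𝒢.baseMinus a c = x then 𝒢.basePlus a h.choose else 1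

theorem baseMap_baseMinus (a : E) (c : 𝒢.Ge (𝒢.posEdge a)) :
    𝒢.baseMap a (𝒢.baseMinus a c) = 𝒢.basePlus a c := by
  have h : ∃ c', 𝒢.baseMinus a c' = 𝒢.baseMinus a c := ⟨c, rfl⟩
  rw [baseMap, dif_pos h, 𝒢.baseMinus_injective a h.choose_spec]

theorem BaseIso.baseMap_eq {a : E} {x y : Monoid.CoprodI 𝒢.Gv} (h : 𝒢.BaseIso a x y) :
    𝒢.baseMap a x = y := by
  obtain ⟨c, rfl, rfl⟩ := h
  exact 𝒢.baseMap_baseMinus a c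

/-- The multiple HNN extension of the free product of the vertex groups, with a stable letter for
each edge. -/
noncomputable def hnnData : HNNData (Monoid.CoprodI 𝒢.Gv) E where
  inv := X.inv
  inv_inv := X.inv_inv
  K a := (𝒢.baseMinus a).range
  ψ := 𝒢.baseMap
  ψ_mem := by
    rintro a _ ⟨c, rfl⟩
    rw [baseMap_baseMinus]
    obtain ⟨d, h1, -⟩ := 𝒢.baseIso_inv.2 (⟨c, rfl, rfl⟩ : 𝒢.BaseIso a _ _)
    exact ⟨d, h1.symm⟩
  ψ_mul := by
    rintro a _ ⟨c, rfl⟩ _ ⟨d, rfl⟩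
    rw [← map_mul, baseMap_baseMinus, baseMap_baseMinus, baseMap_baseMinus, map_mul]
  ψ_ψ := by
    rintro a _ ⟨c, rfl⟩
    rw [baseMap_baseMinus]
    exact (𝒢.baseIso_inv.2 (⟨c, rfl, rfl⟩ : 𝒢.BaseIso a _ _)).baseMap_eq

/-- The letter `t_a` in the fundamental group. -/
def stable (a : E) : 𝒢.Pi1 T := QuotientGroup.mk' _ (𝒢.letter a)

/-- The natural map from the free product of the vertex groups to the fundamental group. -/
def basePi1 : Monoid.CoprodI 𝒢.Gv →* 𝒢.Pi1 T := Monoid.CoprodI.lift (𝒢.toPi1 T)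

theorem basePi1_baseVtx (s : V) (g : 𝒢.Gv s) :
    𝒢.basePi1 T (𝒢.baseVtx s g) = 𝒢.toPi1 T s g := Monoid.CoprodI.lift_of _ _

theorem basePi1_baseMinus (a : E) (c : 𝒢.Ge (𝒢.posEdge a)) :
    𝒢.basePi1 T (𝒢.baseMinus a c) = 𝒢.edgeMinusHom T a c := by
  unfold baseMinus edgeMinusHom
  split_ifs <;> exact 𝒢.basePi1_baseVtx T _ _

theorem basePi1_basePlus (a : E) (c : 𝒢.Ge (𝒢.posEdge a)) :
    𝒢.basePi1 T (𝒢.basePlus a c) = 𝒢.edgePlusHom T a c := by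
  unfold basePlus edgePlusHom
  split_ifs <;> exact 𝒢.basePi1_baseVtx T _ _

theorem edgeIso_iff {a : E} {x y : 𝒢.Pi1 T} :
    𝒢.EdgeIso T a x y ↔
      ∃ x' y', 𝒢.BaseIso a x' y' ∧ x = 𝒢.basePi1 T x' ∧ y = 𝒢.basePi1 T y' := by
  constructor
  · rintro ⟨c, rfl, rfl⟩
    exact ⟨_, _, ⟨c, rfl, rfl⟩, (𝒢.basePi1_baseMinus T a c).symm,
      (𝒢.basePi1_basePlus T a c).symm⟩
  · rintro ⟨_, _, ⟨c, rfl, rfl⟩, rfl, rfl⟩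
    exact ⟨c, 𝒢.basePi1_baseMinus T a c, 𝒢.basePi1_basePlus T a c⟩

theorem edgeIso_inv {a : E} {x y : 𝒢.Pi1 T} :
    𝒢.EdgeIso T (X.inv a) y x ↔ 𝒢.EdgeIso T a x y := by
  simp only [edgeIso_iff]
  constructor
  · rintro ⟨y', x', h, h1, h2⟩
    exact ⟨x', y', 𝒢.baseIso_inv.1 h, h2, h1⟩
  · rintro ⟨y', x', h, h1, h2⟩
    exact ⟨x', y', 𝒢.baseIso_inv.2 h, h2, h1⟩

theorem mem_edgeMinus {a : E} {x : 𝒢.Pi1 T} : x ∈ 𝒢.edgeMinus T a ↔ ∃ y, 𝒢.EdgeIso T a x y := by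
  constructor
  · rintro ⟨c, rfl⟩
    exact ⟨_, c, rfl, rfl⟩
  · rintro ⟨_, c, rfl, -⟩
    exact ⟨c, rfl⟩

theorem mem_edgePlus {a : E} {y : 𝒢.Pi1 T} : y ∈ 𝒢.edgePlus T a ↔ ∃ x, 𝒢.EdgeIso T a x y := by
  constructor
  · rintro ⟨c, rfl⟩
    exact ⟨_, c, rfl, rfl⟩
  · rintro ⟨_, c, -, rfl⟩
    exact ⟨c, rfl⟩

theorem edgeMinus_inv (a : E) : 𝒢.edgeMinus T (X.inv a) = 𝒢.edgePlus T a := by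
  ext x
  rw [mem_edgeMinus, mem_edgePlus]
  exact exists_congr fun y => 𝒢.edgeIso_inv T

theorem mk_eq_one {x : 𝒢.FreeAmbient} (h : x ∈ 𝒢.relators T) :
    (QuotientGroup.mk' (Subgroup.normalClosure (𝒢.relators T))) x = 1 :=
  (QuotientGroup.eq_one_iff x).2 (Subgroup.subset_normalClosure h)

theorem stable_inv (a : E) : 𝒢.stable T (X.inv a) = (𝒢.stable T a)⁻¹ := by
  have := 𝒢.mk_eq_one T (Or.inl (Or.inr ⟨a, rfl⟩))
  rw [inv_inv, map_mul] at this
  exact eq_inv_of_mul_eq_one_left this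

theorem stable_of_mem {a : E} (h : a ∈ T) : 𝒢.stable T a = 1 :=
  𝒢.mk_eq_one T (Or.inr ⟨a, h, rfl⟩)

variable {𝒢 T}

theorem EdgeIso.minus_mem {a : E} {x y : 𝒢.Pi1 T} (h : 𝒢.EdgeIso T a x y) :
    x ∈ 𝒢.vertexSubgroup T (X.o a) := by
  obtain ⟨c, rfl, -⟩ := h
  unfold edgeMinusHom
  split_ifs with ha
  · rw [show X.o a = X.o (𝒢.posEdge a) by rw [𝒢.posEdge_of_mem ha]]
    exact ⟨_, rfl⟩
  · rw [show X.o a = X.e (𝒢.posEdge a) by rw [𝒢.posEdge_of_notMem ha, X.e_inv]]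
    exact ⟨_, rfl⟩

theorem EdgeIso.plus_mem {a : E} {x y : 𝒢.Pi1 T} (h : 𝒢.EdgeIso T a x y) :
    y ∈ 𝒢.vertexSubgroup T (X.e a) := ((𝒢.edgeIso_inv T).2 h).minus_mem

/-- For a positive edge this is a defining relator; the other orientation follows by inverting both
the edge isomorphism and the letter. -/
theorem EdgeIso.mul_stable {a : E} {x y : 𝒢.Pi1 T} (h : 𝒢.EdgeIso T a x y) :
    x * 𝒢.stable T a = 𝒢.stable T a * y := by
  have key : ∀ b ∈ 𝒢.pos, ∀ x y, 𝒢.EdgeIso T b x y →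
      x * 𝒢.stable T b = 𝒢.stable T b * y := by
    intro b hb x y h
    obtain ⟨x', y', h', rfl, rfl⟩ := (𝒢.edgeIso_iff T).1 h
    obtain ⟨c, rfl, rfl⟩ := (𝒢.baseIso_of_mem hb).1 h'
    have := 𝒢.mk_eq_one T (Or.inl (Or.inl ⟨⟨b, hb⟩, c, rfl⟩))
    rw [map_mul, map_inv, mul_inv_eq_one, map_mul, map_mul, map_inv] at this
    rw [basePi1_baseVtx, basePi1_baseVtx]
    exact eq_mul_inv_iff_mul_eq.1 this
  by_cases ha : a ∈ 𝒢.pos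
  · exact key a ha x y h
  · have := key _ (𝒢.inv_mem_pos ha) y x ((𝒢.edgeIso_inv T).2 h)
    rw [stable_inv] at this
    rw [mul_inv_eq_iff_eq_mul.1 this]
    group

/-- The fundamental group is generated by the vertex groups and the letters. -/
theorem pi1_induction {p : 𝒢.Pi1 T → Prop} (h_one : p 1) (hv : ∀ s, ∀ g ∈ 𝒢.vertexSubgroup T s, p g)
    (ht : ∀ a, p (𝒢.stable T a)) (h_mul : ∀ x y, p x → p y → p (x * y)) (γ : 𝒢.Pi1 T) :
    p γ := by
  obtain ⟨x, rfl⟩ := QuotientGroup.mk'_surjective _ γ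
  induction x using Monoid.Coprod.induction_on with
  | inl m =>
    induction m using Monoid.CoprodI.induction_on with
    | one => rwa [map_one, map_one]
    | of s g => exact hv s _ ⟨g, rfl⟩
    | mul x y hx hy =>
      rw [map_mul, map_mul]
      exact h_mul _ _ hx hy
  | inr n =>
    induction n using FreeGroup.induction_on with
    | C1 => rwa [map_one, map_one]
    | of a => exact ht a
    | inv_of a _ =>
      rw [map_inv, map_inv]
      exact 𝒢.stable_inv T a ▸ ht (X.inv a)
    | mul x y hx hy =>
      rw [map_mul, map_mul]
      exact h_mul _ _ hx hy
  | mul x y hx hy =>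
    rw [map_mul]
    exact h_mul _ _ hx hy

end GraphOfGroups

/-! ### The action of the fundamental group on normal words -/

namespace GraphOfGroups

variable {V : Type uV} {E : Type uE} {X : SerreGraph V E}

section Action

variable (𝒢 : GraphOfGroups.{uV, uE, uG, uA} X) {T : Set E} (hT : X.IsMaximalTree T) (s₀ : V)

/-- The permutation of the normal words given by the path of the tree from `s₀` to `s`. -/
noncomputable def treePerm (s : V) : Equiv.Perm 𝒢.hnnData.NormalWord :=
  ((hT.path s₀ s).map 𝒢.hnnData.letterPerm).prod

/-- The action on the normal words of the free product of the vertex groups and of the free group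
on the edges. -/
noncomputable def ambientAction : 𝒢.FreeAmbient →* Equiv.Perm 𝒢.hnnData.NormalWord :=
  Monoid.Coprod.lift
    (Monoid.CoprodI.lift fun s => (MulAut.conj (𝒢.treePerm hT s₀ s)).toMonoidHom.comp
      (𝒢.hnnData.basePerm.comp (𝒢.baseVtx s)))
    (FreeGroup.lift fun a => 𝒢.treePerm hT s₀ (X.o a) * 𝒢.hnnData.letterPerm a *
      (𝒢.treePerm hT s₀ (X.e a))⁻¹)

theorem ambientAction_vtx (s : V) (g : 𝒢.Gv s) :
    𝒢.ambientAction hT s₀ (𝒢.vtx s g) = 𝒢.treePerm hT s₀ s *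
      𝒢.hnnData.basePerm (𝒢.baseVtx s g) * (𝒢.treePerm hT s₀ s)⁻¹ := by
  simp [ambientAction, vtx]

theorem ambientAction_letter (a : E) :
    𝒢.ambientAction hT s₀ (𝒢.letter a) = 𝒢.treePerm hT s₀ (X.o a) *
      𝒢.hnnData.letterPerm a * (𝒢.treePerm hT s₀ (X.e a))⁻¹ := by
  simp [ambientAction, letter]

variable {𝒢} in
theorem BaseIso.letterPerm_mul {a : E} {x y : Monoid.CoprodI 𝒢.Gv} (h : 𝒢.BaseIso a x y) :
    𝒢.hnnData.letterPerm a * 𝒢.hnnData.basePerm y =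
      𝒢.hnnData.basePerm x * 𝒢.hnnData.letterPerm a := by
  have h' := 𝒢.baseIso_inv.2 h
  have hK : y ∈ 𝒢.hnnData.K (𝒢.hnnData.inv a) := by
    obtain ⟨c, hc, -⟩ := h'
    exact ⟨c, hc.symm⟩
  rw [HNNData.letterPerm_mul_basePerm _ hK]
  exact congrArg (fun z => 𝒢.hnnData.basePerm z * _) h'.baseMap_eq

theorem ambientAction_relators {x : 𝒢.FreeAmbient} (hx : x ∈ 𝒢.relators T) :
    𝒢.ambientAction hT s₀ x = 1 := by
  rcases hx with (⟨a, c, rfl⟩ | ⟨a, rfl⟩) | ⟨a, ha, rfl⟩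
  · have h := ((𝒢.baseIso_of_mem a.2).2 ⟨c, rfl, rfl⟩).letterPerm_mul
    rw [map_mul, map_inv, map_mul, map_mul, map_inv, ambientAction_vtx, ambientAction_vtx,
      ambientAction_letter, mul_inv_eq_one, eq_mul_inv_iff_mul_eq]
    simp only [mul_assoc, inv_mul_cancel_left, mul_right_inj]
    rw [← mul_assoc, ← mul_assoc (𝒢.hnnData.letterPerm _)]
    exact congrArg (· * _) h.symm
  · have h := 𝒢.hnnData.letterPerm_inv a
    change 𝒢.hnnData.letterPerm (X.inv a) = _ at h
    rw [inv_inv, map_mul, ambientAction_letter, ambientAction_letter, X.e_inv, h]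
    change 𝒢.treePerm hT s₀ (X.e a) * _ * _ * _ = 1
    group
  -- The tree permutations form a potential for the letters of `T`, so a tree letter acts trivially.
  · rw [ambientAction_letter, mul_inv_eq_one]
    exact hT.prod_path_mul _ 𝒢.hnnData.letterPerm_inv s₀ ha

/-- The action of the fundamental group on the normal words. -/
noncomputable def action : 𝒢.Pi1 T →* Equiv.Perm 𝒢.hnnData.NormalWord :=
  QuotientGroup.lift _ (𝒢.ambientAction hT s₀) (fun _ hx =>
    Subgroup.normalClosure_le_normal (N := (𝒢.ambientAction hT s₀).ker)
      (fun _ hy => 𝒢.ambientAction_relators hT s₀ hy) hx)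

theorem action_toPi1 (s : V) (g : 𝒢.Gv s) :
    𝒢.action hT s₀ (𝒢.toPi1 T s g) = 𝒢.treePerm hT s₀ s *
      𝒢.hnnData.basePerm (𝒢.baseVtx s g) * (𝒢.treePerm hT s₀ s)⁻¹ :=
  𝒢.ambientAction_vtx hT s₀ s g

theorem action_stable (a : E) :
    𝒢.action hT s₀ (𝒢.stable T a) = 𝒢.treePerm hT s₀ (X.o a) *
      𝒢.hnnData.letterPerm a * (𝒢.treePerm hT s₀ (X.e a))⁻¹ :=
  𝒢.ambientAction_letter hT s₀ a

theorem exists_action_eq {s : V} {x : 𝒢.Pi1 T} (hx : x ∈ 𝒢.vertexSubgroup T s) :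
    ∃ y, 𝒢.basePi1 T y = x ∧ 𝒢.action hT s₀ x =
      𝒢.treePerm hT s₀ s * 𝒢.hnnData.basePerm y * (𝒢.treePerm hT s₀ s)⁻¹ := by
  obtain ⟨g, rfl⟩ := hx
  exact ⟨𝒢.baseVtx s g, 𝒢.basePi1_baseVtx T s g, 𝒢.action_toPi1 hT s₀ s g⟩

include hT in
-- `G_s` acts by a conjugate of left multiplication on the heads of normal words, which is faithful.
theorem toPi1_injective (s : V) : Function.Injective (𝒢.toPi1 T s) := by
  intro g g' h
  have h' := congrArg (𝒢.action hT s) h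
  rw [action_toPi1, action_toPi1, mul_left_inj, mul_right_inj] at h'
  exact 𝒢.baseVtx_injective s (𝒢.hnnData.basePerm_injective h')

end Action

/-! ### Reduced words in the fundamental group -/

section Words

variable (𝒢 : GraphOfGroups.{uV, uE, uG, uA} X) (T : Set E)

/-- `t_{a_1} h_1 ⋯ t_{a_n} h_n` is a word from `s` to `t`: the edges form a path from `s` to `t`
and each `h_i` belongs to the group of the extremity of `a_i`. -/
def IsWord : V → List (E × 𝒢.Pi1 T) → V → Prop
  | s, [], t => s = t
  | s, x :: l, t => X.o x.1 = s ∧ x.2 ∈ 𝒢.vertexSubgroup T (X.e x.1) ∧ IsWord (X.e x.1) l t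

/-- A word is reduced if it contains no `t_a h t_{-a}` with `h ∈ G_a⁺`. -/
def IsReducedWord (l : List (E × 𝒢.Pi1 T)) : Prop :=
  l.IsChain fun x y => y.1 = X.inv x.1 → x.2 ∉ 𝒢.edgePlus T x.1

/-- The value of a word in the fundamental group. -/
def wordVal (l : List (E × 𝒢.Pi1 T)) : 𝒢.Pi1 T := (l.map fun x => 𝒢.stable T x.1 * x.2).prod

theorem wordVal_nil : 𝒢.wordVal T [] = 1 := rfl

theorem wordVal_cons (x : E × 𝒢.Pi1 T) (l : List (E × 𝒢.Pi1 T)) :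
    𝒢.wordVal T (x :: l) = 𝒢.stable T x.1 * x.2 * 𝒢.wordVal T l := by
  simp [wordVal]

theorem basePi1_mem_edgeMinus {a : E} {y : Monoid.CoprodI 𝒢.Gv} (hy : y ∈ 𝒢.hnnData.K a) :
    𝒢.basePi1 T y ∈ 𝒢.edgeMinus T a := by
  obtain ⟨c, rfl⟩ := hy
  exact ⟨c, (𝒢.basePi1_baseMinus T a c).symm⟩

variable {𝒢 T}

/-- The tree permutations of consecutive syllables telescope. The lifted word stays reduced because
a lift in the subgroup `K` of `-a` would map into `G_a⁺`. -/
theorem IsWord.exists_action_eq (hT : X.IsMaximalTree T) (s₀ : V) {s t : V}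
    {l : List (E × 𝒢.Pi1 T)} (hw : 𝒢.IsWord T s l t) (hl : 𝒢.IsReducedWord T l) :
    ∃ m : List (E × Monoid.CoprodI 𝒢.Gv),
      List.Forall₂ (fun x y => x.1 = y.1 ∧ 𝒢.basePi1 T x.2 = y.2) m l ∧
      𝒢.action hT s₀ (𝒢.wordVal T l) =
        𝒢.treePerm hT s₀ s * 𝒢.hnnData.evalPerm m * (𝒢.treePerm hT s₀ t)⁻¹ ∧
      m.IsChain fun x y => y.1 = 𝒢.hnnData.inv x.1 → x.2 ∉ 𝒢.hnnData.K (𝒢.hnnData.inv x.1) := by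
  induction l generalizing s with
  | nil =>
    obtain rfl : s = t := hw
    exact ⟨[], .nil, by simp [wordVal, HNNData.evalPerm], by simp⟩
  | cons z l ih =>
    obtain ⟨rfl, h2, h3⟩ := hw
    obtain ⟨m, hm1, hm2, hm3⟩ := ih h3 hl.tail
    obtain ⟨y, hy1, hy2⟩ := 𝒢.exists_action_eq hT s₀ h2
    refine ⟨(z.1, y) :: m, .cons ⟨rfl, hy1⟩ hm1, ?_, ?_⟩
    · rw [wordVal_cons, map_mul, map_mul, hm2, hy2, action_stable, HNNData.evalPerm_cons]
      group
    · cases hm1 with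
      | nil => exact List.isChain_singleton _
      | cons h h' =>
        refine List.IsChain.cons_cons (fun e1 e2 => ?_) hm3
        refine (List.isChain_cons_cons.1 hl).1 (h.1 ▸ e1) ?_
        rw [← hy1, ← edgeMinus_inv]
        exact 𝒢.basePi1_mem_edgeMinus T e2

/-- Two reduced words whose values differ by elements of the vertex groups begin with the same
letter. -/
theorem IsWord.exists_eq_cons (hT : X.IsMaximalTree T) {s t : V} {l l' : List (E × 𝒢.Pi1 T)}
    (hw : 𝒢.IsWord T s l t) (hl : 𝒢.IsReducedWord T l)
    (hw' : 𝒢.IsWord T s l' t) (hl' : 𝒢.IsReducedWord T l')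
    {x v : 𝒢.Pi1 T} (hx : x ∈ 𝒢.vertexSubgroup T s) (hv : v ∈ 𝒢.vertexSubgroup T t)
    (e : x * 𝒢.wordVal T l = 𝒢.wordVal T l' * v) {a : E} {h : 𝒢.Pi1 T}
    {l₁ : List (E × 𝒢.Pi1 T)} (hcons : l = (a, h) :: l₁) :
    (∃ h' l₁', l' = (a, h') :: l₁') ∧ x ∈ 𝒢.edgeMinus T a := by
  obtain ⟨m, hm1, hm2, hm3⟩ := hw.exists_action_eq hT s hl
  obtain ⟨m', hm1', hm2', hm3'⟩ := hw'.exists_action_eq hT s hl'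
  obtain ⟨y, rfl, hy⟩ := 𝒢.exists_action_eq hT s hx
  obtain ⟨z, rfl, hz⟩ := 𝒢.exists_action_eq hT s hv
  have e1 := congrArg (𝒢.action hT s) e
  rw [map_mul, map_mul, hm2, hm2', hy, hz] at e1
  have e2 : 𝒢.hnnData.basePerm y * 𝒢.hnnData.evalPerm m =
      𝒢.hnnData.evalPerm m' * 𝒢.hnnData.basePerm z := by
    simp only [mul_assoc, inv_mul_cancel_left, mul_right_inj] at e1
    rwa [← mul_assoc, ← mul_assoc, mul_left_inj] at e1
  -- Evaluated at the trivial normal word, both sides keep their first letters. Comparing these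
  -- gives the common edge `a`; comparing heads, which lie in `K a` up to the factor `y`, gives `y ∈
  -- K a`.
  have e3 := congrArg (fun p => (p (𝒢.hnnData.baseWord 1)).1) e2
  have e4 : 𝒢.hnnData.basePerm z (𝒢.hnnData.baseWord 1) = 𝒢.hnnData.baseWord z :=
    Subtype.ext (Prod.ext (mul_one z) rfl)
  simp only [Equiv.Perm.mul_apply, e4, HNNData.basePerm_apply] at e3
  subst hcons
  cases hm1 with
  | @cons p _ m₁ _ hp _ =>
    obtain ⟨h1, r, n, h2⟩ := 𝒢.hnnData.evalPerm_baseWord _ 1 hm3 p.1 p.2 m₁ rfl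
    rw [h2] at e3
    cases hm1' with
    | nil => exact absurd (congrArg Prod.snd e3) (List.cons_ne_nil _ _)
    | @cons q q' m₁' l₁' hq _ =>
      obtain ⟨h1', r', n', h2'⟩ := 𝒢.hnnData.evalPerm_baseWord _ z hm3' q.1 q.2 m₁' rfl
      have e5 := congrArg Prod.snd e3
      rw [h2'] at e5
      have e6 : p.1 = q.1 := (Prod.mk.inj (List.cons.inj e5).1).1
      obtain rfl : p.1 = a := hp.1
      refine ⟨⟨q'.2, l₁', ?_⟩, 𝒢.basePi1_mem_edgeMinus T ?_⟩
      · rw [e6, hq.1]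
      · rw [← e6] at h1'
        have e7 := congrArg Prod.fst e3
        rw [← e7] at h1'
        exact (Subgroup.mul_mem_cancel_right _ h1).1 h1'

/-- A value in `G_s` would let a nonempty reduced word be compared with the empty one. -/
theorem IsWord.wordVal_notMem (hT : X.IsMaximalTree T) {s : V} {l : List (E × 𝒢.Pi1 T)}
    (hw : 𝒢.IsWord T s l s) (hl : 𝒢.IsReducedWord T l) (h : l ≠ []) :
    𝒢.wordVal T l ∉ 𝒢.vertexSubgroup T s := by
  intro hv
  obtain ⟨x, l₁, rfl⟩ := List.exists_cons_of_ne_nil h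
  obtain ⟨⟨_, _, h'⟩, -⟩ := hw.exists_eq_cons hT hl (l' := []) rfl List.isChain_nil (one_mem _) hv
    (by rw [wordVal_nil]) rfl
  exact List.cons_ne_nil _ _ h'.symm

variable (𝒢 T) in
/-- `γ` is the value of `h₀ t_{a_1} h_1 ⋯ t_{a_n} h_n` with `h₀ ∈ G_s`, for a reduced word from `s`
to `t`. -/
def IsReducedVal (s t : V) (γ : 𝒢.Pi1 T) : Prop :=
  ∃ h₀ ∈ 𝒢.vertexSubgroup T s, ∃ l, 𝒢.IsWord T s l t ∧ 𝒢.IsReducedWord T l ∧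
    γ = h₀ * 𝒢.wordVal T l

theorem IsReducedVal.vertex_mul {s t : V} {γ g : 𝒢.Pi1 T} (h : 𝒢.IsReducedVal T s t γ)
    (hg : g ∈ 𝒢.vertexSubgroup T s) : 𝒢.IsReducedVal T s t (g * γ) := by
  obtain ⟨h₀, hh, l, h1, h2, rfl⟩ := h
  exact ⟨g * h₀, mul_mem hg hh, l, h1, h2, (mul_assoc _ _ _).symm⟩

/-- Prefixing `t_a` breaks reducedness only at `t_a h₀ t_{-a}` with `h₀ ∈ G_a⁺`; that segment
collapses to an element of `G_a⁻`. -/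
theorem IsReducedVal.stable_mul {a : E} {t : V} {γ : 𝒢.Pi1 T}
    (h : 𝒢.IsReducedVal T (X.e a) t γ) :
    𝒢.IsReducedVal T (X.o a) t (𝒢.stable T a * γ) := by
  obtain ⟨h₀, hh, l, h1, h2, rfl⟩ := h
  by_cases hc : ∃ k l', l = (X.inv a, k) :: l' ∧ h₀ ∈ 𝒢.edgePlus T a
  · obtain ⟨k, l', rfl, hp⟩ := hc
    obtain ⟨x, hx⟩ := (𝒢.mem_edgePlus T).1 hp
    obtain ⟨-, h4, h5⟩ := h1
    simp only [X.e_inv] at h4 h5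
    refine ⟨x * k, mul_mem hx.minus_mem h4, l', h5, h2.tail, ?_⟩
    rw [wordVal_cons, ← mul_assoc, ← hx.mul_stable, stable_inv]
    group
  · refine ⟨1, one_mem _, (a, h₀) :: l, ⟨rfl, hh, h1⟩, ?_, ?_⟩
    · cases l with
      | nil => exact List.isChain_singleton _
      | cons z l =>
        refine List.IsChain.cons_cons (fun e1 e2 => hc ⟨z.2, l, ?_, e2⟩) h2
        rw [← show z.1 = X.inv a from e1]
    · rw [wordVal_cons, one_mul, mul_assoc]

/-- Letters of the tree equal `1` in `Γ`, so prefixing a tree path leaves the value unchanged. -/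
theorem IsReducedVal.change_origin (hT : X.IsMaximalTree T) {s t : V} {γ : 𝒢.Pi1 T}
    (h : 𝒢.IsReducedVal T s t γ) (s' : V) : 𝒢.IsReducedVal T s' t γ := by
  have key : ∀ (l : List E) (s' : V), (∀ a ∈ l, a ∈ T) → X.IsPath s' l s →
      𝒢.IsReducedVal T s' t γ := by
    intro l
    induction l with
    | nil =>
      rintro s' - rfl
      exact h
    | cons a l ih =>
      rintro s' h1 ⟨rfl, h2⟩
      have := (ih _ (fun b hb => h1 b (by simp [hb])) h2).stable_mul
      rwa [𝒢.stable_of_mem T (h1 a (by simp)), one_mul] at this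
  exact key _ s' (fun _ => hT.mem_of_mem_path) (hT.isPath_path s' s)

theorem isReducedVal (hT : X.IsMaximalTree T) (s : V) (γ : 𝒢.Pi1 T) :
    𝒢.IsReducedVal T s s γ := by
  -- Stability under left multiplication, unlike the claim itself, passes to products of generators.
  have key : ∀ δ, 𝒢.IsReducedVal T s s δ → 𝒢.IsReducedVal T s s (γ * δ) := by
    induction γ using pi1_induction with
    | h_one => simp
    | hv s' g hg => exact fun δ h => ((h.change_origin hT s').vertex_mul hg).change_origin hT s
    | ht a => exact fun δ h => (h.change_origin hT (X.e a)).stable_mul.change_origin hT s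
    | h_mul x y hx hy => exact fun δ h => mul_assoc x y δ ▸ hx _ (hy _ h)
  have := key 1 ⟨1, one_mem _, [], rfl, List.isChain_nil, (mul_one 1).symm⟩
  rwa [mul_one] at this

end Words

end GraphOfGroups

/-! ### Circuits from commutation, and the consequences of minimality -/

namespace GraphOfGroups

variable {V : Type uV} {E : Type uE} {X : SerreGraph V E}
  {𝒢 : GraphOfGroups.{uV, uE, uG, uA} X} {T : Set E}

/-- The equation says `h₀⁻¹uh₀ · w = w · v` with `w` reduced, so `h₀⁻¹uh₀ ∈ G_a⁻` for the first edge
`a`. Moving it across `t_a` replaces it by its image under `φ_a`, and the same equation holds for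
the shorter word. The last clauses record that the route has the edges and vertex elements of the
word. -/
theorem IsWord.exists_trajet (hT : X.IsMaximalTree T) {s t : V} {l : List (E × 𝒢.Pi1 T)}
    (hw : 𝒢.IsWord T s l t) (hl : 𝒢.IsReducedWord T l) {u v h₀ : 𝒢.Pi1 T}
    (hu : u ∈ 𝒢.vertexSubgroup T s) (hv : v ∈ 𝒢.vertexSubgroup T t)
    (hh : h₀ ∈ 𝒢.vertexSubgroup T s)
    (e : u * (h₀ * 𝒢.wordVal T l) = h₀ * 𝒢.wordVal T l * v) :
    ∃ τ : 𝒢.Trajet T s t u v, τ.n = l.length ∧ τ.h 0 = h₀ ∧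
      ∀ i : Fin τ.n, l[i.val]? = some (τ.a i, τ.h i.succ) := by
  induction l generalizing s u h₀ with
  | nil =>
    obtain rfl : s = t := hw
    rw [wordVal_nil, mul_one] at e
    refine ⟨⟨0, fun _ => s, Fin.elim0, Fin.elim0, Fin.elim0, fun _ => h₀, hu, hv, rfl, rfl,
      fun i => i.elim0, fun i => i.elim0, fun i => i.elim0, fun _ => hh, fun i => ?_⟩, rfl, rfl,
      fun i => i.elim0⟩
    obtain rfl : i = 0 := Fin.fin_one_eq_zero i
    exact eq_mul_inv_of_mul_eq e
  | cons z l ih =>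
    obtain ⟨a, h⟩ := z
    obtain ⟨rfl, h2, h3⟩ := id hw
    have hx : h₀⁻¹ * u * h₀ ∈ 𝒢.vertexSubgroup T (X.o a) :=
      mul_mem (mul_mem (inv_mem hh) hu) hh
    obtain ⟨y, hy⟩ := (𝒢.mem_edgeMinus T).1 (hw.exists_eq_cons hT hl hw hl hx hv
      (by simp only [mul_assoc] at e ⊢; rw [e]; group) rfl).2
    have e' : y * (h * 𝒢.wordVal T l) = h * 𝒢.wordVal T l * v := by
      rw [wordVal_cons] at e
      apply mul_left_cancel (a := h₀ * 𝒢.stable T a)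
      calc h₀ * 𝒢.stable T a * (y * (h * 𝒢.wordVal T l))
          = h₀ * (𝒢.stable T a * y) * (h * 𝒢.wordVal T l) := by simp only [mul_assoc]
        _ = u * (h₀ * (𝒢.stable T a * h * 𝒢.wordVal T l)) := by
          rw [← hy.mul_stable]; group
        _ = _ := by rw [e]; simp only [mul_assoc]
    obtain ⟨τ, hn, h0, hτ⟩ := ih h3 hl.tail hy.plus_mem h2 e'
    refine ⟨⟨τ.n + 1, Fin.cons (X.o a) τ.s, Fin.cons a τ.a, Fin.cons (h₀⁻¹ * u * h₀) τ.cm,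
      Fin.cons y τ.cp, Fin.cons h₀ τ.h, hu, hv, rfl, ?_, ?_, ?_, ?_, ?_, ?_⟩, ?_, ?_, ?_⟩
    · rw [← Fin.succ_last, Fin.cons_succ]
      exact τ.s_last
    · refine Fin.cases rfl fun i => ?_
      rw [← Fin.succ_castSucc]
      simpa only [Fin.cons_succ] using τ.o_edge i
    · refine Fin.cases ?_ fun i => ?_
      · simpa only [Fin.cons_succ, Fin.cons_zero] using τ.s_first.symm
      · simpa only [Fin.cons_succ] using τ.e_edge i
    · refine Fin.cases hy fun i => ?_
      simpa only [Fin.cons_succ] using τ.edgeIso i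
    · refine Fin.cases hh fun i => ?_
      simpa only [Fin.cons_succ] using τ.h_mem i
    · intro i
      rw [← Fin.cons_snoc_eq_snoc_cons]
      revert i
      refine Fin.cases ?_ fun i => ?_
      · simp only [Fin.cons_zero]
        group
      · simpa only [Fin.cons_succ] using τ.conj i
    · simpa using hn
    · rfl
    · refine Fin.cases ?_ fun i => ?_
      · simp only [Fin.cons_succ, Fin.cons_zero, h0]
        rfl
      · simpa only [Fin.cons_succ, Fin.val_succ, List.getElem?_cons_succ] using hτ i

/-- Without circuits, the centralizer of a nontrivial element of a vertex group is contained in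
this vertex group. -/
theorem IsWithoutCircuit.mem_vertexSubgroup (hc : 𝒢.IsWithoutCircuit T) (hT : X.IsMaximalTree T)
    {s : V} {u γ : 𝒢.Pi1 T} (hu : u ∈ 𝒢.vertexSubgroup T s) (hu1 : u ≠ 1)
    (e : u * γ = γ * u) : γ ∈ 𝒢.vertexSubgroup T s := by
  obtain ⟨h₀, hh, l, hw, hl, rfl⟩ := isReducedVal hT s γ
  obtain ⟨τ, hn, -, hτ⟩ := hw.exists_trajet hT hl hu hu hh e
  -- A backtrack in the route would be one in the reduced word.
  have h0 : τ.n = 0 := by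
    refine hc s u hu1 τ fun i j hij => ?_
    rintro ⟨h1, h2⟩
    have hi := hτ i
    have hj := hτ j
    obtain ⟨hi', hi⟩ := List.getElem?_eq_some_iff.1 hi
    obtain ⟨hj', hj⟩ := List.getElem?_eq_some_iff.1 hj
    have := List.isChain_iff_getElem.1 hl i.val (by omega)
    simp only [hij, hi, hj] at this
    exact this h1 h2
  obtain rfl : l = [] := List.length_eq_zero_iff.1 (hn ▸ h0)
  rwa [wordVal_nil, mul_one]

theorem IsMinimal.exists_notMem_edgePlus (hmin : 𝒢.IsMinimal T) (hT : X.IsMaximalTree T) {a : E}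
    (ha : a ∈ T) : ∃ x ∈ 𝒢.vertexSubgroup T (X.e a), x ∉ 𝒢.edgePlus T a := by
  by_cases hp : a ∈ 𝒢.pos
  · exact SetLike.exists_of_lt (hmin a ha hp).2
  · obtain ⟨x, h1, h2⟩ :=
      SetLike.exists_of_lt (hmin _ (hT.inv_mem a ha) (𝒢.inv_mem_pos hp)).1
    exact ⟨x, h1, by rwa [← edgeMinus_inv]⟩

/-- In a minimal graph of groups, if a vertex group is the whole fundamental group, then there is no
other vertex. -/
theorem IsMinimal.eq_of_vertexSubgroup_eq_top (hmin : 𝒢.IsMinimal T) (hT : X.IsMaximalTree T)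
    {s : V} (hs : ∀ γ, γ ∈ 𝒢.vertexSubgroup T s) (s' : V) : s' = s := by
  have h1 := hT.isPath_path s s'
  have h2 : ∀ a ∈ hT.path s s', a ∈ T := fun a => hT.mem_of_mem_path
  cases h : hT.path s s' with
  | nil => rw [h] at h1; exact Eq.symm h1
  | cons a l =>
    rw [h] at h1 h2
    obtain ⟨rfl, -⟩ := h1
    obtain ⟨x, hx, hx'⟩ := hmin.exists_notMem_edgePlus hT (h2 a (by simp))
    -- The closed word `t_a x t_{-a}` is reduced because `x` lies outside `G_a⁺`.
    refine absurd (hs _) (IsWord.wordVal_notMem hT (l := [(a, x), (X.inv a, 1)])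
      ⟨rfl, hx, rfl, one_mem _, X.e_inv a⟩
      (List.IsChain.cons_cons (fun _ => hx') (List.isChain_singleton _)) (List.cons_ne_nil _ _))

/-- If a vertex group is the whole fundamental group, then there is no loop at this vertex. -/
theorem e_ne_of_vertexSubgroup_eq_top (hT : X.IsMaximalTree T) {a : E}
    (hs : ∀ γ, γ ∈ 𝒢.vertexSubgroup T (X.o a)) : X.e a ≠ X.o a := fun h =>
  absurd (hs _) (IsWord.wordVal_notMem hT (l := [(a, 1)]) ⟨rfl, one_mem _, h⟩
    (List.isChain_singleton _) (List.cons_ne_nil _ _))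

theorem center_eq_map_of_vertexSubgroup_eq_top (hT : X.IsMaximalTree T) {s : V}
    (hs : ∀ γ, γ ∈ 𝒢.vertexSubgroup T s) :
    Subgroup.center (𝒢.Pi1 T) = (Subgroup.center (𝒢.Gv s)).map (𝒢.toPi1 T s) := by
  ext z
  simp only [Subgroup.mem_map, Subgroup.mem_center_iff]
  constructor
  · intro hz
    obtain ⟨g, rfl⟩ := hs z
    exact ⟨g, fun g' => 𝒢.toPi1_injective hT s (by rw [map_mul, map_mul, hz]), rfl⟩
  · rintro ⟨g, hg, rfl⟩ γ
    obtain ⟨g', rfl⟩ := hs γ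
    rw [← map_mul, hg, map_mul]

/-- A graph of trivial groups on a single vertex with two pairs of edges has a fundamental group
with trivial centre. -/
theorem center_eq_bot_of_trivial (hT : X.IsMaximalTree T) {s : V} (hs : ∀ s', s' = s)
    (htriv : ∀ s, 𝒢.vertexSubgroup T s = ⊥) {a b : E} (hab : b ≠ a) (hab' : b ≠ X.inv a) :
    Subgroup.center (𝒢.Pi1 T) = ⊥ := by
  rw [eq_bot_iff]
  intro z hz
  rw [Subgroup.mem_center_iff] at hz
  obtain ⟨h₀, hh, l, hw, hl, rfl⟩ := isReducedVal hT s z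
  rw [htriv, Subgroup.mem_bot] at hh
  subst hh
  rw [one_mul] at hz ⊢
  rcases List.eq_nil_or_concat l with rfl | ⟨l', y, hly⟩
  · exact one_mem _
  exfalso
  rw [List.concat_eq_append] at hly
  obtain ⟨x, l'', hlx⟩ := List.exists_cons_of_ne_nil (l := l) (by simp [hly])
  -- With first letter `x` and last letter `y` of the central word `z`, the letter `c` is chosen so
  -- that `t_c z` and `z t_c` are both reduced and begin differently, contradicting their equality.
  -- If a candidate equals `-y`, its inverse serves.
  have key : ∃ c, c ≠ x.1 ∧ x.1 ≠ X.inv c ∧ c ≠ X.inv y.1 := by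
    have key' : ∀ c, c ≠ x.1 → x.1 ≠ X.inv c → ∃ c, c ≠ x.1 ∧ x.1 ≠ X.inv c ∧ c ≠ X.inv y.1 := by
      intro c h1 h2
      by_cases hc : c = X.inv y.1
      · refine ⟨X.inv c, h2.symm, by rw [X.inv_inv]; exact h1.symm, ?_⟩
        rw [← hc]
        exact X.inv_ne c
      · exact ⟨c, h1, h2, hc⟩
    by_cases h1 : a = x.1 ∨ x.1 = X.inv a
    · refine key' b ?_ ?_
      · rcases h1 with h1 | h1
        · exact h1 ▸ hab
        · exact h1 ▸ hab'
      · intro h2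
        have h3 : b = X.inv x.1 := by rw [h2, X.inv_inv]
        rcases h1 with h1 | h1
        · exact hab' (h1 ▸ h3)
        · rw [h1, X.inv_inv] at h3
          exact hab h3
    · push Not at h1
      exact key' a h1.1 h1.2
  obtain ⟨c, hc1, hc2, hc3⟩ := key
  have append : ∀ (l : List (E × 𝒢.Pi1 T)) (s' : V), 𝒢.IsWord T s' l s →
      𝒢.IsWord T s' (l ++ [(c, 1)]) s := by
    intro l
    induction l with
    | nil => exact fun s' _ => ⟨(hs _).trans (hs _).symm, one_mem _, hs _⟩
    | cons z l ih => exact fun s' h => ⟨h.1, h.2.1, ih _ h.2.2⟩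
  have hw1 : 𝒢.IsWord T s ((c, 1) :: l) s := ⟨hs _, one_mem _, by rwa [hs (X.e c)]⟩
  have hl1 : 𝒢.IsReducedWord T ((c, 1) :: l) := by
    rw [hlx] at hl ⊢
    exact List.IsChain.cons_cons (fun h => absurd h hc2) hl
  have hl2 : 𝒢.IsReducedWord T (l ++ [(c, 1)]) := by
    refine List.isChain_append.2 ⟨hl, List.isChain_singleton _, ?_⟩
    simpa [hly] using fun h : c = X.inv y.1 => absurd h hc3
  obtain ⟨⟨h', l₁, e⟩, -⟩ := hw1.exists_eq_cons hT hl1 (append l s hw) hl2 (one_mem _) (one_mem _)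
    (by
      rw [wordVal_cons, one_mul, mul_one, mul_one, hz]
      simp [wordVal]) rfl
  rw [hlx] at e
  exact hc1 (congrArg Prod.fst (List.cons.inj e).1).symm

/-- A graph of trivial groups on a single pair of loops has fundamental group `ℤ`. -/
theorem nonempty_mulEquiv_int (hsub : ∀ s, Subsingleton (𝒢.Gv s)) (hempty : ∀ a, a ∉ T)
    {a : E} (ha : ∀ b, b = a ∨ b = X.inv a) : Nonempty (𝒢.Pi1 T ≃* Multiplicative ℤ) := by
  classical
  -- The degree: `t_a` counts `1`, `t_{-a}` counts `-1`, vertex groups count `0`.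
  let f : 𝒢.FreeAmbient →* Multiplicative ℤ :=
    Monoid.Coprod.lift 1 (FreeGroup.lift fun b => if b = a then Multiplicative.ofAdd 1
      else (Multiplicative.ofAdd 1)⁻¹)
  have hf1 : ∀ s g, f (𝒢.vtx s g) = 1 := fun s g => by simp [f, vtx]
  have hf2 : ∀ b, f (𝒢.letter b) = if b = a then Multiplicative.ofAdd 1
      else (Multiplicative.ofAdd 1)⁻¹ := fun b => by simp [f, letter]
  have hf : ∀ x ∈ 𝒢.relators T, f x = 1 := by
    rintro x ((⟨b, h, rfl⟩ | ⟨b, rfl⟩) | ⟨b, hb, rfl⟩)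
    · simp [hf1]
    · rw [inv_inv, map_mul, hf2, hf2]
      rcases ha b with rfl | rfl
      · rw [if_neg (X.inv_ne _), if_pos rfl, inv_mul_cancel]
      · rw [X.inv_inv, if_pos rfl, if_neg (X.inv_ne _), mul_inv_cancel]
    · exact absurd hb (hempty b)
  let F : 𝒢.Pi1 T →* Multiplicative ℤ := QuotientGroup.lift _ f fun _ hx =>
    Subgroup.normalClosure_le_normal (N := f.ker) hf hx
  have hF : F (𝒢.stable T a) = Multiplicative.ofAdd 1 := (hf2 a).trans (if_pos rfl)
  have hgen : ∀ γ, γ ∈ Subgroup.zpowers (𝒢.stable T a) := by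
    intro γ
    induction γ using pi1_induction with
    | h_one => exact one_mem _
    | hv s g hg =>
      obtain ⟨g, rfl⟩ := hg
      rw [Subsingleton.elim g 1, map_one]
      exact one_mem _
    | ht b =>
      rcases ha b with rfl | rfl
      · exact Subgroup.mem_zpowers _
      · rw [stable_inv]
        exact inv_mem (Subgroup.mem_zpowers _)
    | h_mul x y hx hy => exact mul_mem hx hy
  refine ⟨MulEquiv.ofBijective F ⟨?_, ?_⟩⟩
  · refine (injective_iff_map_eq_one F).2 fun γ h => ?_
    obtain ⟨n, rfl⟩ := hgen γ
    simp only [map_zpow, hF, ← ofAdd_zsmul, ofAdd_eq_one, smul_eq_mul, mul_one] at h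
    simp [h]
  · intro n
    refine ⟨𝒢.stable T a ^ n.toAdd, ?_⟩
    rw [map_zpow, hF, ← ofAdd_zsmul, smul_eq_mul, mul_one, ofAdd_toAdd]

end GraphOfGroups

/-! ### The trichotomy for the centre -/

open GraphOfGroups in
theorem mainTheorem10 {V : Type uV} {E : Type uE} [Finite V] [Finite E]
    (X : SerreGraph V E) (hX : X.IsConnected)
    (𝒢 : GraphOfGroups.{uV, uE, uG, uA} X)
    (T : Set E) (hT : X.IsMaximalTree T)
    (hmin : 𝒢.IsMinimal T) (hcirc : 𝒢.IsWithoutCircuit T) :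
    -- the centre of the fundamental group is trivial
    Subgroup.center (𝒢.Pi1 T) = ⊥ ∨
    -- `X` is a single vertex `s` (and no edge), and the centre is that of `G_s`
    (∃ s : V, (∀ s' : V, s' = s) ∧ IsEmpty E ∧ Function.Injective (𝒢.toPi1 T s) ∧
      Subgroup.center (𝒢.Pi1 T) = (Subgroup.center (𝒢.Gv s)).map (𝒢.toPi1 T s)) ∨
    -- `X` is a single vertex `s` with trivial group and a single unoriented edge
    (∃ s : V, (∀ s' : V, s' = s) ∧ (∃ a : E, ∀ b : E, b = a ∨ b = X.inv a) ∧
      Subsingleton (𝒢.Gv s) ∧ Subgroup.center (𝒢.Pi1 T) = ⊤ ∧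
      Nonempty (𝒢.Pi1 T ≃* Multiplicative ℤ)) := by
  by_cases hZ : Subgroup.center (𝒢.Pi1 T) = ⊥
  · exact Or.inl hZ
  obtain ⟨z, hz, hz1⟩ := (Subgroup.ne_bot_iff_exists_ne_one.1 hZ)
    |>.elim fun z h => (⟨z.1, z.2, fun h' => h (Subtype.ext h')⟩ :
      ∃ z ∈ Subgroup.center (𝒢.Pi1 T), z ≠ 1)
  have hcomm := Subgroup.mem_center_iff.1 hz
  by_cases hu : ∃ s, ∃ u ∈ 𝒢.vertexSubgroup T s, u ≠ 1
  · obtain ⟨s, u, hu, hu1⟩ := hu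
    have hzs := hcirc.mem_vertexSubgroup hT hu hu1 (hcomm u)
    have hs : ∀ γ, γ ∈ 𝒢.vertexSubgroup T s := fun γ =>
      hcirc.mem_vertexSubgroup hT hzs hz1 (hcomm γ).symm
    have hV := hmin.eq_of_vertexSubgroup_eq_top hT hs
    refine Or.inr (Or.inl ⟨s, hV, ⟨fun a => ?_⟩, 𝒢.toPi1_injective hT s,
      center_eq_map_of_vertexSubgroup_eq_top hT hs⟩)
    exact e_ne_of_vertexSubgroup_eq_top hT (a := a) (by rwa [hV (X.o a)])
      ((hV _).trans (hV _).symm)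
  · push Not at hu
    have htriv : ∀ s, 𝒢.vertexSubgroup T s = ⊥ := fun s => (Subgroup.eq_bot_iff_forall _).2 (hu s)
    have hsub : ∀ s, Subsingleton (𝒢.Gv s) := fun s => ⟨fun g g' =>
      𝒢.toPi1_injective hT s ((hu s _ ⟨g, rfl⟩).trans (hu s _ ⟨g', rfl⟩).symm)⟩
    -- A trivial vertex group has no proper subgroup, so minimality excludes tree edges.
    have hempty : ∀ a, a ∉ T := fun a ha => by
      obtain ⟨x, hx, hx'⟩ := hmin.exists_notMem_edgePlus hT ha
      exact hx' (hu _ x hx ▸ one_mem _)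
    have hV : ∀ s s' : V, s' = s := fun s s' => by
      have h := hT.isPath_path s s'
      rw [List.eq_nil_iff_forall_not_mem.2 fun a ha => hempty a (hT.mem_of_mem_path ha)] at h
      exact Eq.symm h
    obtain ⟨a⟩ : Nonempty E := by
      by_contra hE
      exact hz1 (pi1_induction (p := (· = 1)) rfl hu (fun a => absurd ⟨a⟩ hE)
        (fun x y hx hy => by rw [hx, hy, one_mul]) z)
    have hE : ∀ b, b = a ∨ b = X.inv a := fun b => by
      by_contra! hb
      exact hZ (center_eq_bot_of_trivial hT (hV (X.o a)) htriv hb.1 hb.2)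
    obtain ⟨φ⟩ := nonempty_mulEquiv_int hsub hempty hE
    refine Or.inr (Or.inr ⟨X.o a, hV _, ⟨a, hE⟩, hsub _, ?_, ⟨φ⟩⟩)
    refine (Subgroup.eq_top_iff' _).2 fun γ => Subgroup.mem_center_iff.2 fun δ => ?_
    exact φ.injective (by rw [map_mul, map_mul, mul_comm])
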